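/- A $(6,14)$-coloring of the complete graph $K_n$ is a coloring of its edges in which every $6$-clique spans at least $14$ distinct colors, and $f(n,6,14)$ denotes the minimum number of colors in a $(6,14)$-coloring of $K_n$. For all $n\ge 6$, \[ \frac56\binom n2\;\le\; f(n,6,14)\;\le\;\frac56\binom n2+O(n), \] where the implied constant is absolute. Furthermore, $f(n,6,14)=\frac56\binom n2$ whenever $n\ge 6$ and $n$ is congruent to $1$ or $4$ modulo $12$. -/

import Mathlib

/-- The set of colors that the edge coloring `χ` of the complete graph on `V` uses on the edges
with both endpoints in `S`. -/
def colorsWithin {V K : Type*} (χ : SimpleGraph.TopEdgeLabeling V K) (S : Finset V) : Set K :=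
  {c | ∃ (x y : V) (h : x ≠ y), x ∈ S ∧ y ∈ S ∧ χ.get x y h = c}

/-- A `(p, q)`-coloring: every `p`-clique of the complete graph on `V` spans at least `q` distinct
colors. -/
def IsPQColoring {V K : Type*} (p q : ℕ) (χ : SimpleGraph.TopEdgeLabeling V K) : Prop :=
  ∀ S : Finset V, S.card = p → q ≤ (colorsWithin χ S).ncard

/-- The generalized Ramsey number `f(n, p, q)`: the least `k` such that the complete graph on `n`
vertices has a `(p, q)`-coloring with colors from a set of size `k`. -/
noncomputable def genRamsey (n p q : ℕ) : ℕ :=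
  sInf {k : ℕ | ∃ χ : SimpleGraph.TopEdgeLabeling (Fin n) (Fin k), IsPQColoring p q χ}

/-! Lower bound: keep one edge of each colour. Every other edge `d` shares its colour with a kept
edge, and the two fit in a 4-set `T d`. If two of these 4-sets shared an edge, their union would
have at most six vertices and two coincidences of colour, so some 6-clique would span at most 13
colours (`IsPQColoring.six_lt_card`). Hence the 4-sets are edge-disjoint, at most a sixth of the
edges are discarded, and at least 5/6 of them have distinct colours.

Upper bound: in a Steiner system S(2,4,m), give each block five colours of its own, one of them used
on two opposite edges. Two blocks meet in at most one point, so six vertices contain at most one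
block and lose at most one colour. Restricting to `n ≤ m` vertices costs O(n) colours when m is the
next admissible size.

Most of the work is the existence of S(2,4,3u+1) for u ≡ 0, 1 mod 4, obtained from a design with u
groups of size 3 (`hasTripleGDD_fin`). The set of such u is closed under linear spaces
(`HasTripleGDD.of_lines`). Truncated transversal designs supply linear spaces for a strong
induction, whose base cases are explicit. -/

/-! ### Group divisible designs with groups of size 3 -/

/-- A group divisible design on `α × ZMod 3` with block size `4` whose groups are the fibres of the
first projection. Blocks are injective functions on `Fin 4`, and an ordered pair of points in
distinct groups occurs in a unique position of a unique block. -/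
def HasTripleGDD (α : Type) : Prop :=
  ∃ (ι : Type) (B : ι → Fin 4 → α × ZMod 3),
    (∀ i a b, a ≠ b → (B i a).1 ≠ (B i b).1) ∧
    ∀ p q : α × ZMod 3, p.1 ≠ q.1 →
      ∃! w : ι × Fin 4 × Fin 4, B w.1 w.2.1 = p ∧ B w.1 w.2.2 = q

theorem HasTripleGDD.of_equiv {α β : Type} (e : α ≃ β) (h : HasTripleGDD α) : HasTripleGDD β := by
  obtain ⟨ι, B, hB, hu⟩ := h
  refine ⟨ι, fun i a => (e (B i a).1, (B i a).2), fun i a b hab => ?_, fun p q hpq => ?_⟩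
  · simpa using hB i a b hab
  · obtain ⟨w, hw, hw'⟩ := hu (e.symm p.1, p.2) (e.symm q.1, q.2) (by simpa using hpq)
    refine ⟨w, ⟨?_, ?_⟩, fun v hv => hw' v ⟨?_, ?_⟩⟩
    · simp [hw.1]
    · simp [hw.2]
    · rw [← hv.1]; simp
    · rw [← hv.2]; simp

theorem HasTripleGDD.of_subsingleton (α : Type) [Subsingleton α] : HasTripleGDD α :=
  ⟨Empty, fun i => i.elim, fun i => i.elim, fun _ _ h => (h (Subsingleton.elim _ _)).elim⟩

/-- A linear space all of whose lines carry a group divisible design carries one itself. -/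
theorem HasTripleGDD.of_lines {α ι : Type} (L : ι → Set α)
    (hL : ∀ x y, x ≠ y → ∃! i, x ∈ L i ∧ y ∈ L i) (h : ∀ i, HasTripleGDD (L i)) :
    HasTripleGDD α := by
  choose κ B hB hu using h
  refine ⟨Σ i, κ i, fun i a => ((B i.1 i.2 a).1, (B i.1 i.2 a).2), ?_, ?_⟩
  · rintro ⟨i, k⟩ a b hab h
    exact hB i k a b hab (Subtype.ext h)
  · rintro ⟨x, e⟩ ⟨y, f⟩ hxy
    obtain ⟨i, ⟨hx, hy⟩, hi⟩ := hL x y hxy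
    obtain ⟨⟨k, a, b⟩, ⟨h1, h2⟩, hk⟩ := hu i (⟨x, hx⟩, e) (⟨y, hy⟩, f)
      (fun h => hxy (congrArg Subtype.val h))
    refine ⟨(⟨i, k⟩, a, b), ⟨?_, ?_⟩, ?_⟩
    · simp only at h1 ⊢; rw [h1]
    · simp only at h2 ⊢; rw [h2]
    · rintro ⟨⟨j, k'⟩, a', b'⟩ ⟨g1, g2⟩
      simp only [Prod.mk.injEq] at g1 g2
      obtain rfl : j = i := hi j
        ⟨g1.1 ▸ (B j k' a').1.2, g2.1 ▸ (B j k' b').1.2⟩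
      have := hk (k', a', b') ⟨Prod.ext (Subtype.ext g1.1) g1.2, Prod.ext (Subtype.ext g2.1) g2.2⟩
      simp only [Prod.mk.injEq] at this
      obtain ⟨rfl, rfl, rfl⟩ := this
      rfl

/-- The translates of a difference family relative to `0 × ZMod 3`. -/
theorem HasTripleGDD.of_differenceFamily {H σ : Type} [AddCommGroup H]
    (D : σ → Fin 4 → H × ZMod 3)
    (hD : ∀ i a b, a ≠ b → (D i a).1 ≠ (D i b).1)
    (hex : ∀ d : H × ZMod 3, d.1 ≠ 0 → ∃ i a b, D i a - D i b = d)
    (hun : ∀ i a b j a' b', a ≠ b → D i a - D i b = D j a' - D j b' → i = j ∧ a = a' ∧ b = b') :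
    HasTripleGDD H := by
  refine ⟨σ × (H × ZMod 3), fun i a => D i.1 a + i.2, ?_, ?_⟩
  · rintro ⟨i, t⟩ a b hab
    simpa using hD i a b hab
  · intro p q hpq
    obtain ⟨i, a, b, h⟩ := hex (p - q) (by simpa [sub_eq_zero] using hpq)
    refine ⟨((i, p - D i a), a, b), ⟨by simp, ?_⟩, ?_⟩
    · simp only
      rw [sub_eq_sub_iff_add_eq_add] at h
      rw [eq_comm, ← sub_eq_zero, ← sub_eq_zero.2 h]; abel
    · rintro ⟨⟨j, t⟩, a', b'⟩ ⟨h1, h2⟩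
      simp only at h1 h2
      have hab : a ≠ b := by
        rintro rfl
        rw [sub_self, eq_comm, sub_eq_zero] at h
        exact hpq (congrArg Prod.fst h)
      obtain ⟨rfl, rfl, rfl⟩ := hun i a b j a' b' hab (by rw [h, ← h1, ← h2]; abel)
      rw [← h1]; simp

/-- The translates of a difference family, with three infinite points `(none, e)`. The difference
of two points is recorded with a flag telling whether the first point is finite. -/
theorem HasTripleGDD.option_of_differenceFamily {H σ : Type} [AddCommGroup H]
    (D : σ → Fin 4 → Option H × ZMod 3)
    (hD : ∀ i a b, a ≠ b → (D i a).1 ≠ (D i b).1)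
    (hex : ∀ (x : H) (e : ZMod 3), x ≠ 0 → ∃ i a b,
      Option.map₂ (· - ·) (D i a).1 (D i b).1 = some x ∧ (D i a).2 - (D i b).2 = e)
    (hex' : ∀ e : ZMod 3, ∃ i a b,
      (D i a).1.isSome = true ∧ (D i b).1.isSome = false ∧ (D i a).2 - (D i b).2 = e)
    (hun : ∀ i a b j a' b', a ≠ b → a' ≠ b' → (D i a).1.isSome = (D j a').1.isSome →
      Option.map₂ (· - ·) (D i a).1 (D i b).1 = Option.map₂ (· - ·) (D j a').1 (D j b').1 →
      (D i a).2 - (D i b).2 = (D j a').2 - (D j b').2 → i = j ∧ a = a' ∧ b = b') :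
    HasTripleGDD (Option H) := by
  have ne_of {i a b} (h : (D i a).1 ≠ (D i b).1) : a ≠ b := fun hab => h (by rw [hab])
  have htr : ∀ (o : Option H) (x t : H), o.map (· + t) = some x ↔ o = some (x - t) := by
    intro o x t
    cases o <;> simp [eq_sub_iff_add_eq]
  have key : ∀ (x : H) (e : ZMod 3) (q : Option H × ZMod 3), some x ≠ q.1 →
      ∃! w : (σ × (H × ZMod 3)) × Fin 4 × Fin 4,
        ((D w.1.1 w.2.1).1.map (· + w.1.2.1), (D w.1.1 w.2.1).2 + w.1.2.2) = (some x, e) ∧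
        ((D w.1.1 w.2.2).1.map (· + w.1.2.1), (D w.1.1 w.2.2).2 + w.1.2.2) = q := by
    rintro x e ⟨_ | y, f⟩ hxy
    · obtain ⟨i, a, b, ha, hb, he⟩ := hex' (e - f)
      obtain ⟨u, hu⟩ := Option.isSome_iff_exists.1 ha
      have hv : (D i b).1 = none := by simpa using hb
      have hab : a ≠ b := ne_of (by rw [hu, hv]; simp)
      refine ⟨((i, (x - u, e - (D i a).2)), a, b), ⟨?_, ?_⟩, ?_⟩
      · simp [hu]
      · simp only [hv, Option.map_none, Prod.mk.injEq, true_and]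
        rw [sub_eq_sub_iff_add_eq_add] at he
        linear_combination -he
      · rintro ⟨⟨j, t, s⟩, a', b'⟩ ⟨h1, h2⟩
        simp only [Prod.mk.injEq, htr, Option.map_eq_none_iff] at h1 h2
        have hab' : a' ≠ b' := ne_of (by rw [h1.1, h2.1]; simp)
        obtain ⟨rfl, rfl, rfl⟩ := hun i a b j a' b' hab hab' (by simp [hu, h1.1])
          (by simp [hv, h2.1]) (by rw [he, ← h1.2, ← h2.2]; abel)
        rw [hu, Option.some_inj] at h1
        simp [h1.1, ← h1.2]
    · obtain ⟨i, a, b, hd, he⟩ := hex (x - y) (e - f)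
        (by simpa [sub_eq_zero] using hxy)
      rw [Option.map₂_eq_some_iff] at hd
      obtain ⟨u, v, hu, hv, huv⟩ := hd
      rw [Option.mem_def] at hu hv
      have hab : a ≠ b := by
        rintro rfl
        rw [hu, Option.some_inj] at hv
        subst hv
        rw [sub_self, eq_comm, sub_eq_zero] at huv
        exact hxy (congrArg some huv)
      refine ⟨((i, (x - u, e - (D i a).2)), a, b), ⟨?_, ?_⟩, ?_⟩
      · simp [hu]
      · simp only [hv, Option.map_some, Prod.mk.injEq, Option.some_inj]
        constructor
        · rw [sub_eq_sub_iff_add_eq_add] at huv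
          rw [eq_comm, ← sub_eq_zero, ← sub_eq_zero.2 huv]; abel
        · linear_combination -he
      · rintro ⟨⟨j, t, s⟩, a', b'⟩ ⟨h1, h2⟩
        simp only [Prod.mk.injEq, htr] at h1 h2
        have hab' : a' ≠ b' := ne_of (by
          rw [h1.1, h2.1]
          simpa using hxy)
        obtain ⟨rfl, rfl, rfl⟩ := hun i a b j a' b' hab hab' (by simp [hu, h1.1])
          (by simp only [hu, hv, h1.1, h2.1, Option.map₂_some_some, huv]; simp)
          (by rw [he, ← h1.2, ← h2.2]; abel)
        rw [hu, Option.some_inj] at h1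
        simp [h1.1, ← h1.2]
  refine ⟨σ × (H × ZMod 3), fun i a => ((D i.1 a).1.map (· + i.2.1), (D i.1 a).2 + i.2.2), ?_, ?_⟩
  · rintro ⟨i, t⟩ a b hab h
    exact hD i a b hab (Option.map_injective (add_left_injective t.1) h)
  · rintro ⟨_ | x, e⟩ ⟨_ | y, f⟩ hxy
    · exact (hxy rfl).elim
    · obtain ⟨⟨i, a, b⟩, ⟨h1, h2⟩, h3⟩ := key y f (none, e) (by simp)
      refine ⟨(i, b, a), ⟨h2, h1⟩, ?_⟩
      rintro ⟨j, a', b'⟩ ⟨g1, g2⟩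
      have := h3 (j, b', a') ⟨g2, g1⟩
      simp only [Prod.mk.injEq] at this ⊢
      tauto
    · exact key x e _ hxy
    · exact key x e _ hxy

/-! ### Explicit small designs -/

/-- The nine blocks are the non-vertical lines of the affine plane over `ZMod 3`: position 0 records
the slope, and the other positions the values at 0, 1, 2. -/
theorem hasTripleGDD_four : HasTripleGDD (Fin 4) := by
  refine ⟨ZMod 3 × ZMod 3, fun i a => (a, ![i.2, i.1, i.1 + i.2, i.1 + 2 * i.2] a), ?_, ?_⟩
  · intro i a b h; exact h
  · have h1 : ∀ p q : Fin 4 × ZMod 3, p.1 ≠ q.1 → ∃ i : ZMod 3 × ZMod 3,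
        ![i.2, i.1, i.1 + i.2, i.1 + 2 * i.2] p.1 = p.2 ∧
        ![i.2, i.1, i.1 + i.2, i.1 + 2 * i.2] q.1 = q.2 := by decide +kernel
    have h2 : ∀ (a b : Fin 4) (i j : ZMod 3 × ZMod 3), a ≠ b →
        ![i.2, i.1, i.1 + i.2, i.1 + 2 * i.2] a = ![j.2, j.1, j.1 + j.2, j.1 + 2 * j.2] a →
        ![i.2, i.1, i.1 + i.2, i.1 + 2 * i.2] b = ![j.2, j.1, j.1 + j.2, j.1 + 2 * j.2] b →
        i = j := by decide +kernel
    rintro ⟨a, e⟩ ⟨b, f⟩ hab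
    obtain ⟨i, hi, hi'⟩ := h1 _ _ hab
    refine ⟨(i, a, b), ⟨Prod.ext rfl hi, Prod.ext rfl hi'⟩, ?_⟩
    rintro ⟨j, a', b'⟩ ⟨g1, g2⟩
    simp only [Prod.mk.injEq] at g1 g2
    obtain ⟨rfl, g1⟩ := g1
    obtain ⟨rfl, g2⟩ := g2
    rw [h2 _ _ i j hab (hi.trans g1.symm) (hi'.trans g2.symm)]

/-- Two base blocks have 2 · 12 ordered differences, matching the 8 · 3 differences to be covered.
-/
theorem hasTripleGDD_nine : HasTripleGDD (ZMod 3 × ZMod 3) := by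
  refine .of_differenceFamily
    (![![((0, 0), 0), ((0, 1), 0), ((1, 0), 0), ((1, 1), 1)],
      ![((0, 0), 0), ((0, 1), 2), ((1, 2), 1), ((2, 2), 0)]] :
      Fin 2 → Fin 4 → (ZMod 3 × ZMod 3) × ZMod 3)
    ?_ ?_ ?_ <;> decide +kernel

theorem hasTripleGDD_five : HasTripleGDD (ZMod 5) := by
  refine .of_differenceFamily
    (![![(0, 0), (1, 0), (4, 2), (2, 2)]] : Fin 1 → Fin 4 → ZMod 5 × ZMod 3)
    ?_ ?_ ?_ <;> decide +kernel

theorem hasTripleGDD_seventeen : HasTripleGDD (ZMod 17) := by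
  refine .of_differenceFamily
    (![![(0, 0), (1, 0), (16, 2), (11, 0)], ![(0, 0), (1, 2), (4, 1), (10, 2)],
     ![(0, 0), (2, 0), (5, 0), (14, 2)], ![(0, 0), (2, 2), (13, 0), (9, 1)]] : Fin 4 → Fin 4 → ZMod 17 × ZMod 3)
    ?_ ?_ ?_ <;> decide +kernel

/-- Two base blocks and their images under multiplication of the first coordinate by 10, which has
order 5 modulo 41. -/
theorem hasTripleGDD_forty_one : HasTripleGDD (ZMod 41) := by
  refine .of_differenceFamily
    (![![(0, 0), (1, 0), (40, 2), (8, 0)], ![(0, 0), (10, 0), (31, 2), (39, 0)],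
     ![(0, 0), (18, 0), (23, 2), (21, 0)], ![(0, 0), (16, 0), (25, 2), (5, 0)],
     ![(0, 0), (37, 0), (4, 2), (9, 0)], ![(0, 0), (1, 2), (15, 0), (30, 1)],
     ![(0, 0), (10, 2), (27, 0), (13, 1)], ![(0, 0), (18, 2), (24, 0), (7, 1)],
     ![(0, 0), (16, 2), (35, 0), (29, 1)], ![(0, 0), (37, 2), (22, 0), (3, 1)]] : Fin 10 → Fin 4 → ZMod 41 × ZMod 3)
    ?_ ?_ ?_ <;> decide +kernel

/-- The block through infinity has second coordinates 0, 1, 2 at its finite points, so it meets each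
infinite difference once. It has 6 finite differences and the other block 12, together 6 · 3. -/
theorem hasTripleGDD_eight : HasTripleGDD (Option (ZMod 7)) := by
  refine .option_of_differenceFamily
    (![![(some 0, 0), (some 1, 1), (some 3, 2), (none, 0)],
     ![(some 0, 0), (some 1, 0), (some 6, 1), (some 3, 0)]] : Fin 2 → Fin 4 → Option (ZMod 7) × ZMod 3)
    ?_ ?_ ?_ ?_ <;> decide +kernel

theorem hasTripleGDD_twelve : HasTripleGDD (Option (ZMod 11)) := by
  refine .option_of_differenceFamily
    (![![(some 0, 0), (some 1, 1), (some 3, 2), (none, 0)],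
     ![(some 0, 0), (some 1, 0), (some 5, 2), (some 9, 0)],
     ![(some 0, 0), (some 1, 2), (some 6, 2), (some 4, 0)]] : Fin 3 → Fin 4 → Option (ZMod 11) × ZMod 3)
    ?_ ?_ ?_ ?_ <;> decide +kernel

/-- The multiplier 6 has order 3 modulo 43. The first two blocks come from the subgroup {1, 6, 36};
the other nine form three orbits under multiplication by 6. -/
theorem hasTripleGDD_forty_four : HasTripleGDD (Option (ZMod 43)) := by
  refine .option_of_differenceFamily
    (![![(some 1, 0), (some 6, 1), (some 36, 2), (none, 0)],
     ![(some 0, 0), (some 1, 0), (some 6, 0), (some 36, 0)],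
     ![(some 0, 0), (some 1, 1), (some 27, 1), (some 16, 1)],
     ![(some 0, 0), (some 6, 1), (some 33, 1), (some 10, 1)],
     ![(some 0, 0), (some 36, 1), (some 26, 1), (some 17, 1)],
     ![(some 0, 0), (some 1, 2), (some 21, 0), (some 40, 1)],
     ![(some 0, 0), (some 6, 2), (some 40, 0), (some 25, 1)],
     ![(some 0, 0), (some 36, 2), (some 25, 0), (some 21, 1)],
     ![(some 0, 0), (some 2, 0), (some 32, 2), (some 14, 1)],
     ![(some 0, 0), (some 12, 0), (some 20, 2), (some 41, 1)],
     ![(some 0, 0), (some 29, 0), (some 34, 2), (some 31, 1)]] : Fin 11 → Fin 4 → Option (ZMod 43) × ZMod 3)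
    ?_ ?_ ?_ ?_ <;> decide +kernel


/-! ### Steiner systems from group divisible designs -/

theorem HasTripleGDD.of_card_eq {α β : Type} [Finite α] [Finite β] (h : HasTripleGDD α)
    (hc : Nat.card α = Nat.card β) : HasTripleGDD β :=
  h.of_equiv (Finite.card_eq.1 hc).some

theorem HasTripleGDD.of_nat_card {α : Type} [Finite α] {n : ℕ} (h : HasTripleGDD (Fin n))
    (hc : Nat.card α = n) : HasTripleGDD α :=
  h.of_card_eq (by simp [hc])

theorem HasTripleGDD.to_fin {α : Type} [Finite α] {n : ℕ} (h : HasTripleGDD α)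
    (hc : Nat.card α = n) : HasTripleGDD (Fin n) :=
  h.of_card_eq (by simp [hc])

/-- A Steiner system `S(2, 4, V)`: blocks are injective functions on `Fin 4`, and an ordered pair of
distinct points occurs in a unique position of a unique block. -/
def IsQuadSystem {V ι : Type} (B : ι → Fin 4 → V) : Prop :=
  (∀ i, Function.Injective (B i)) ∧
    ∀ x y, x ≠ y → ∃! w : ι × Fin 4 × Fin 4, B w.1 w.2.1 = x ∧ B w.1 w.2.2 = y

theorem IsQuadSystem.comp_equiv {V W ι : Type} {B : ι → Fin 4 → V} (hB : IsQuadSystem B)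
    (e : V ≃ W) : IsQuadSystem fun i a => e (B i a) := by
  refine ⟨fun i => e.injective.comp (hB.1 i), fun x y hxy => ?_⟩
  simpa only [← Equiv.eq_symm_apply] using hB.2 (e.symm x) (e.symm y) (by simpa using hxy)

/-- Adjoining a common point to the groups of a design with groups of size `3`. -/
theorem HasTripleGDD.exists_isQuadSystem {α : Type} (h : HasTripleGDD α) :
    ∃ (ι : Type) (B : ι → Fin 4 → Option (α × ZMod 3)), IsQuadSystem B := by
  obtain ⟨ι, B, hB, hu⟩ := h
  let ε : Fin 4 ≃ Option (ZMod 3) := finSuccEquiv 3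
  have hBi : ∀ i, Function.Injective (B i) := fun i a b hab => by
    by_contra hne
    exact hB i a b hne (congrArg Prod.fst hab)
  have hinr : ∀ x : α, Function.Injective fun a => (ε a).map fun e => (x, e) := fun x =>
    (Option.map_injective (Prod.mk_right_injective x)).comp ε.injective
  refine ⟨α ⊕ ι, Sum.elim (fun x a => (ε a).map fun e => (x, e)) (fun i a => some (B i a)), ?_, ?_⟩
  · rintro (x | i)
    · exact hinr x
    · exact (Option.some_injective _).comp (hBi i)
  · have hgroup : ∀ (x : α) (o o' : Option (ZMod 3)), o ≠ o' →
        ∃! w : (α ⊕ ι) × Fin 4 × Fin 4,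
          Sum.elim (fun x a => (ε a).map fun e => (x, e)) (fun i a => some (B i a)) w.1 w.2.1 =
            o.map (fun e => (x, e)) ∧
          Sum.elim (fun x a => (ε a).map fun e => (x, e)) (fun i a => some (B i a)) w.1 w.2.2 =
            o'.map (fun e => (x, e)) := by
      intro x o o' hne
      refine ⟨(.inl x, ε.symm o, ε.symm o'), by simp, ?_⟩
      rintro ⟨y | i, a, b⟩ ⟨h1, h2⟩
      · simp only [Sum.elim_inl] at h1 h2
        obtain rfl : y = x := by
          rcases o with _ | e
          · rcases o' with _ | e'
            · exact (hne rfl).elim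
            · simp only [Option.map_some, Option.map_eq_some_iff, Prod.mk.injEq] at h2
              obtain ⟨_, _, h, _⟩ := h2
              exact h
          · simp only [Option.map_some, Option.map_eq_some_iff, Prod.mk.injEq] at h1
            obtain ⟨_, _, h, _⟩ := h1
            exact h
        have hinj := Option.map_injective (Prod.mk_right_injective (β := ZMod 3) y)
        rw [← hinj h1, ← hinj h2]
        simp
      · rcases o with _ | e
        · simp at h1
        rcases o' with _ | e'
        · simp at h2
        simp only [Sum.elim_inr, Option.map_some, Option.some_inj] at h1 h2
        have hab : a ≠ b := by
          rintro rfl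
          rw [h1] at h2
          exact hne (congrArg (fun z => some z.2) h2)
        exact (hB i a b hab (by rw [h1, h2])).elim
    rintro (_ | ⟨x, e⟩) (_ | ⟨y, f⟩) hne
    · exact (hne rfl).elim
    · exact hgroup y none (some f) (by simp)
    · exact hgroup x (some e) none (by simp)
    · by_cases hxy : x = y
      · subst hxy
        exact hgroup x (some e) (some f) (fun h => hne (by rw [Option.some_inj.1 h]))
      · obtain ⟨⟨i, a, b⟩, ⟨h1, h2⟩, h3⟩ := hu (x, e) (y, f) hxy
        refine ⟨(.inr i, a, b), ⟨congrArg some h1, congrArg some h2⟩, ?_⟩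
        rintro ⟨z | j, a', b'⟩ ⟨g1, g2⟩
        · simp only [Sum.elim_inl, Option.map_eq_some_iff, Prod.mk.injEq] at g1 g2
          obtain ⟨_, _, g1, _⟩ := g1
          obtain ⟨_, _, g2, _⟩ := g2
          exact (hxy (g1.symm.trans g2)).elim
        · simp only [Sum.elim_inr, Option.some_inj] at g1 g2
          have := h3 (j, a', b') ⟨g1, g2⟩
          simp only [Prod.mk.injEq] at this
          simp [this]

/-- The Steiner system on 3u + 1 points is itself a linear space with all lines of size 4. -/
theorem HasTripleGDD.three_mul_add_one {u : ℕ} (h : HasTripleGDD (Fin u)) :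
    HasTripleGDD (Fin (3 * u + 1)) := by
  obtain ⟨ι, B, hB, hu⟩ := h.exists_isQuadSystem
  suffices HasTripleGDD (Option (Fin u × ZMod 3)) from this.to_fin (by simp [mul_comm])
  refine .of_lines (fun i => Set.range (B i)) (fun x y hxy => ?_)
    (fun i => hasTripleGDD_four.of_equiv (Equiv.ofInjective _ (hB i)))
  obtain ⟨⟨i, a, b⟩, ⟨h1, h2⟩, h3⟩ := hu x y hxy
  refine ⟨i, ⟨⟨a, h1⟩, ⟨b, h2⟩⟩, ?_⟩
  rintro j ⟨⟨a', ha⟩, ⟨b', hb⟩⟩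
  exact congrArg Prod.fst (h3 (j, a', b') ⟨ha, hb⟩)

/-! ### Truncated transversal designs -/

/-- The blocks of a transversal design with five groups of size `t`: block `w` meets group `c` in
`transversal w c`. -/
def transversal {t : ℕ} (w : ZMod t × ZMod t) (c : Fin 5) : ZMod t :=
  if c = 4 then w.2 else w.1 + (c.val : ZMod t) * w.2

/-- Group 4 reads off the slope and group c < 4 the value at c. Two values determine the line
because c and d differ by 1, 2 or 3, a unit when t is prime to 6. -/
theorem existsUnique_transversal {t : ℕ} (ht : t.Coprime 6) {c d : Fin 5} (hcd : c ≠ d)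
    (x y : ZMod t) : ∃! w, transversal w c = x ∧ transversal w d = y := by
  have hone : IsUnit (1 : ZMod t) := isUnit_one
  have htwo : IsUnit (2 : ZMod t) := by
    have := (ZMod.isUnit_iff_coprime 2 t).2 (Nat.Coprime.coprime_dvd_right (by norm_num) ht).symm
    exact_mod_cast this
  have hthree : IsUnit (3 : ZMod t) := by
    have := (ZMod.isUnit_iff_coprime 3 t).2 (Nat.Coprime.coprime_dvd_right (by norm_num) ht).symm
    exact_mod_cast this
  wlog hlt : c < d generalizing c d x y
  · simpa only [and_comm] using this hcd.symm y x (lt_of_le_of_ne (not_lt.1 hlt) hcd.symm)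
  have hc : c ≠ 4 := by omega
  by_cases hd : d = 4
  · subst hd
    simp only [transversal, hc, if_false, if_true]
    refine ⟨(x - c.val * y, y), by simp, ?_⟩
    rintro ⟨a, b⟩ ⟨h1, h2⟩
    simp only at h1 h2
    rw [← h1, h2]; simp
  · have hu : IsUnit ((d.val : ZMod t) - (c.val : ZMod t)) := by
      rw [← Nat.cast_sub hlt.le]
      have : d.val - c.val = 1 ∨ d.val - c.val = 2 ∨ d.val - c.val = 3 := by omega
      rcases this with h | h | h <;> rw [h] <;> assumption_mod_cast
    obtain ⟨v, hv⟩ := hu.exists_left_inv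
    simp only [transversal, hc, hd, if_false]
    refine ⟨(x - c.val * (v * (y - x)), v * (y - x)), ⟨by simp, ?_⟩, ?_⟩
    · linear_combination (y - x) * hv
    · rintro ⟨a, b⟩ ⟨h1, h2⟩
      simp only at h1 h2
      have hb : b = v * (y - x) := by
        rw [← h1, ← h2]
        linear_combination (-b) * hv
      rw [← hb, ← h1]; simp

/-- Truncate one group of a transversal design with five groups of size `t` to size `h`, and adjoin
the points of `E` (at most one) to all groups. -/
theorem HasTripleGDD.of_truncated_transversal {t h : ℕ} (E : Type) [Subsingleton E] [Finite E]
    (ht0 : t ≠ 0) (ht : t.Coprime 6) (hht : h ≤ t) (h4 : HasTripleGDD (Fin 4))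
    (h5 : HasTripleGDD (Fin 5))
    (hgt : HasTripleGDD (Fin (t + Nat.card E))) (hgh : HasTripleGDD (Fin (h + Nat.card E))) :
    HasTripleGDD (Fin (4 * t + h + Nat.card E)) := by
  have : NeZero t := ⟨ht0⟩
  have hcard : Nat.card {x : ZMod t // x.val < h} = h := by
    rw [Nat.card_congr (β := Fin h), Nat.card_fin]
    exact
      { toFun := fun x => ⟨x.1.val, x.2⟩
        invFun := fun i => ⟨(i.val : ZMod t), by rw [ZMod.val_cast_of_lt (by omega)]; exact i.2⟩
        left_inv := fun x => Subtype.ext (by simp)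
        right_inv := fun i => Fin.ext (by simp [ZMod.val_cast_of_lt (lt_of_lt_of_le i.2 hht)]) }
  let X (c : Fin 5) : Type := {x : ZMod t // c = 4 → x.val < h}
  have hX4 : Nat.card (X 4) = h := by
    rw [← hcard]; exact Nat.card_congr (Equiv.subtypeEquivRight fun x => by simp)
  have hX : ∀ c, c ≠ 4 → Nat.card (X c) = t := by
    intro c hc
    rw [← Nat.card_zmod t]
    exact Nat.card_congr (Equiv.subtypeUnivEquiv fun x h => (hc h).elim)
  have hXf : ∀ c, Finite (X c) := fun c => inferInstanceAs (Finite (Subtype _))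
  suffices HasTripleGDD ((Σ c, X c) ⊕ E) from this.to_fin (by
    rw [Nat.card_sum, Nat.card_sigma, Fin.sum_univ_five, hX 0 (by decide), hX 1 (by decide),
      hX 2 (by decide), hX 3 (by decide), hX4]
    ring)
  -- The lines are the five groups, each enlarged by `E`, and the truncated blocks.
  refine .of_lines (ι := Fin 5 ⊕ (ZMod t × ZMod t))
    (Sum.elim (fun c => Set.range (Sum.map (Sigma.mk c) id))
      (fun w => {p | ∃ c x, p = .inl ⟨c, x⟩ ∧ x.1 = transversal w c})) ?_ ?_
  · have hE : ∀ c (x : X c) (e : E), ∃! i : Fin 5 ⊕ (ZMod t × ZMod t),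
        (.inl ⟨c, x⟩ : (Σ c, X c) ⊕ E) ∈ Sum.elim (fun c => Set.range (Sum.map (Sigma.mk c) id))
          (fun w => {p | ∃ c x, p = .inl ⟨c, x⟩ ∧ x.1 = transversal w c}) i ∧
        (.inr e : (Σ c, X c) ⊕ E) ∈ Sum.elim (fun c => Set.range (Sum.map (Sigma.mk c) id))
          (fun w => {p | ∃ c x, p = .inl ⟨c, x⟩ ∧ x.1 = transversal w c}) i := by
      intro c x e
      refine ⟨.inl c, ⟨⟨.inl x, rfl⟩, ⟨.inr e, rfl⟩⟩, ?_⟩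
      rintro (d | w) ⟨h1, h2⟩
      · obtain ⟨y | y, hy⟩ := h1
        · simp only [Sum.map_inl, Sum.inl.injEq, Sigma.mk.injEq] at hy
          rw [hy.1]
        · simp at hy
      · obtain ⟨_, _, h, _⟩ := h2
        simp at h
    rintro (⟨c, x⟩ | e) (⟨d, y⟩ | f) hne
    · by_cases hcd : c = d
      · subst hcd
        refine ⟨.inl c, ⟨⟨.inl x, rfl⟩, ⟨.inl y, rfl⟩⟩, ?_⟩
        rintro (d | w) ⟨h1, h2⟩
        · obtain ⟨z | z, hz⟩ := h1
          · simp only [Sum.map_inl, Sum.inl.injEq, Sigma.mk.injEq] at hz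
            rw [hz.1]
          · simp at hz
        · obtain ⟨c', x', hx, hx'⟩ := h1
          obtain ⟨c'', y', hy, hy'⟩ := h2
          obtain ⟨rfl, hx⟩ := Sigma.mk.inj (Sum.inl_injective hx)
          obtain ⟨rfl, hy⟩ := Sigma.mk.inj (Sum.inl_injective hy)
          obtain rfl := eq_of_heq hx
          obtain rfl := eq_of_heq hy
          exact (hne (by rw [Subtype.ext (hx'.trans hy'.symm)])).elim
      · obtain ⟨w, ⟨h1, h2⟩, h3⟩ := existsUnique_transversal ht hcd x.1 y.1
        refine ⟨.inr w, ⟨⟨c, x, rfl, h1.symm⟩, ⟨d, y, rfl, h2.symm⟩⟩, ?_⟩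
        rintro (b | v) ⟨g1, g2⟩
        · obtain ⟨z | z, hz⟩ := g1
          · obtain ⟨z' | z', hz'⟩ := g2
            · simp only [Sum.map_inl, Sum.inl.injEq, Sigma.mk.injEq] at hz hz'
              exact (hcd (hz.1.symm.trans hz'.1)).elim
            · simp at hz'
          · simp at hz
        · obtain ⟨c', x', hx, hx'⟩ := g1
          obtain ⟨d', y', hy, hy'⟩ := g2
          obtain ⟨rfl, hx⟩ := Sigma.mk.inj (Sum.inl_injective hx)
          obtain ⟨rfl, hy⟩ := Sigma.mk.inj (Sum.inl_injective hy)
          obtain rfl := eq_of_heq hx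
          obtain rfl := eq_of_heq hy
          rw [h3 v ⟨hx'.symm, hy'.symm⟩]
    · exact hE c x f
    · simpa only [and_comm] using hE d y e
    · exact (hne (by rw [Subsingleton.elim e f])).elim
  · rintro (c | w)
    · refine HasTripleGDD.of_equiv (Equiv.ofInjective _
        (Sum.map_injective.2 ⟨sigma_mk_injective, Function.injective_id⟩)) ?_
      by_cases hc : c = 4
      · subst hc
        exact hgh.of_nat_card (by rw [Nat.card_sum, hX4])
      · exact hgt.of_nat_card (by rw [Nat.card_sum, hX c hc])
    · have e : {c : Fin 5 // c = 4 → (transversal w c).val < h} ≃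
          {p : (Σ c, X c) ⊕ E | ∃ c x, p = .inl ⟨c, x⟩ ∧ x.1 = transversal w c} := by
        refine Equiv.ofBijective
          (fun c => ⟨.inl ⟨c.1, ⟨transversal w c.1, c.2⟩⟩, c.1, _, rfl, rfl⟩) ⟨?_, ?_⟩
        · intro c d hcd
          exact Subtype.ext (Sigma.mk.inj (Sum.inl_injective (congrArg Subtype.val hcd))).1
        · rintro ⟨_, c, x, rfl, hx⟩
          refine ⟨⟨c, fun hc => hx ▸ x.2 hc⟩, ?_⟩
          simp only [Subtype.mk.injEq, Sum.inl.injEq, Sigma.mk.injEq, heq_eq_eq, true_and]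
          exact Subtype.ext hx.symm
      refine HasTripleGDD.of_equiv e ?_
      -- A block keeps five points or four, according to whether its point in the truncated group
      -- survives.
      by_cases hw : (transversal w 4).val < h
      · refine h5.of_nat_card ?_
        rw [Nat.card_congr (Equiv.subtypeUnivEquiv ?_), Nat.card_fin]
        rintro c rfl
        exact hw
      · refine h4.of_nat_card ?_
        rw [Nat.card_congr (Equiv.subtypeEquivRight (q := fun c => c ≠ 4) ?_),
          Nat.card_eq_fintype_card]
        · decide
        · intro c
          constructor
          · rintro h rfl
            exact hw (h rfl)
          · exact fun h h' => (h h').elim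

theorem hasTripleGDD_four_mul_add {t h : ℕ} (ht0 : t ≠ 0) (ht : t.Coprime 6) (hht : h ≤ t)
    (hgt : HasTripleGDD (Fin t)) (hgh : HasTripleGDD (Fin h)) :
    HasTripleGDD (Fin (4 * t + h)) := by
  simpa using HasTripleGDD.of_truncated_transversal Empty ht0 ht hht hasTripleGDD_four
    (hasTripleGDD_five.to_fin (by simp)) (by simpa using hgt) (by simpa using hgh)

theorem hasTripleGDD_four_mul_add_add_one {t h : ℕ} (ht0 : t ≠ 0) (ht : t.Coprime 6) (hht : h ≤ t)
    (hgt : HasTripleGDD (Fin (t + 1))) (hgh : HasTripleGDD (Fin (h + 1))) :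
    HasTripleGDD (Fin (4 * t + h + 1)) := by
  simpa using HasTripleGDD.of_truncated_transversal Unit ht0 ht hht hasTripleGDD_four
    (hasTripleGDD_five.to_fin (by simp)) (by simpa using hgt) (by simpa using hgh)

/-! ### Existence for all admissible numbers of groups -/

theorem hasTripleGDD_fin (u : ℕ) (hu : u % 4 = 0 ∨ u % 4 = 1) : HasTripleGDD (Fin u) := by
  induction u using Nat.strong_induction_on with
  | _ u ih =>
    -- Here h ≡ u mod 4, so the induction hypothesis covers h as well as t ≡ 1. In `extended`, t + 1
    -- ≡ 0 and h + 1 ≡ u.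
    have plain : ∀ t h, u = 4 * t + h → t ≠ 0 → t.Coprime 6 → h ≤ t → t % 4 = 1 →
        HasTripleGDD (Fin u) := by
      rintro t h rfl h0 ht hht hm
      exact hasTripleGDD_four_mul_add h0 ht hht (ih _ (by omega) (by omega))
        (ih _ (by omega) (by omega))
    have extended : ∀ t h, u = 4 * t + h + 1 → t.Coprime 6 → h ≤ t → t % 4 = 3 →
        HasTripleGDD (Fin u) := by
      rintro t h rfl ht hht hm
      exact hasTripleGDD_four_mul_add_add_one (by omega) ht hht (ih _ (by omega) (by omega))
        (ih _ (by omega) (by omega))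
    have triple : ∀ w, u = 3 * w + 1 → w % 4 < 2 → w ≠ 0 → HasTripleGDD (Fin u) := by
      rintro w rfl h h0
      exact (ih w (by omega) (by omega)).three_mul_add_one
    by_cases hbig : 116 ≤ u
    · have hcop : ∀ k, k % 12 = 1 ∨ k % 12 = 5 → k.Coprime 6 := by
        intro k hk
        exact Nat.Coprime.mul_right (m := 2) (n := 3)
          ((Nat.Prime.coprime_iff_not_dvd Nat.prime_two).2 (by omega)).symm
          ((Nat.Prime.coprime_iff_not_dvd Nat.prime_three).2 (by omega)).symm
      -- Take t to be the largest number up to u / 4 that is 5 or 1 mod 12. In the first case h ≤ 4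
      -- · 7 + 1 = 29, and t ≥ 29 because u ≥ 116 = 4 · 29; in the second h ≤ 13.
      by_cases hr : (u / 4 - 5) % 12 < 8
      · exact plain (u / 4 - (u / 4 - 5) % 12) (u - 4 * (u / 4 - (u / 4 - 5) % 12)) (by omega)
          (by omega) (hcop _ (by omega)) (by omega) (by omega)
      · exact plain (u / 4 - ((u / 4 - 5) % 12 - 8)) (u - 4 * (u / 4 - ((u / 4 - 5) % 12 - 8)))
          (by omega) (by omega) (hcop _ (by omega)) (by omega) (by omega)
    · have hsub : u < 2 → HasTripleGDD (Fin u) := fun h =>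
        have : Subsingleton (Fin u) := Fin.subsingleton_iff_le_one.2 (by omega)
        .of_subsingleton _
      by_cases h1 : u < 2
      · exact hsub h1
      by_cases h2 : u = 13 ∨ u = 16 ∨ u = 28 ∨ u = 37 ∨ u = 40
      · exact triple (u / 3) (by omega) (by omega) (by omega)
      by_cases h3 : 20 ≤ u ∧ u ≤ 25
      · exact plain 5 (u - 20) (by omega) (by omega) (by norm_num) (by omega) (by omega)
      by_cases h4 : 29 ≤ u ∧ u ≤ 36
      · exact extended 7 (u - 29) (by omega) (by norm_num) (by omega) (by omega)
      by_cases h5 : 45 ≤ u ∧ u ≤ 49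
      · exact extended 11 (u - 45) (by omega) (by norm_num) (by omega) (by omega)
      by_cases h6 : 52 ≤ u ∧ u ≤ 65
      · exact plain 13 (u - 52) (by omega) (by omega) (by norm_num) (by omega) (by omega)
      by_cases h7 : 68 ≤ u ∧ u ≤ 85
      · exact plain 17 (u - 68) (by omega) (by omega) (by norm_num) (by omega) (by omega)
      by_cases h8 : 88 ≤ u ∧ u ≤ 96
      · exact extended 19 (u - 77) (by omega) (by norm_num) (by omega) (by omega)
      by_cases h9 : u = 97
      · exact extended 23 4 (by omega) (by norm_num) (by omega) (by omega)
      by_cases h10 : 100 ≤ u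
      · exact plain 25 (u - 100) (by omega) (by omega) (by norm_num) (by omega) (by omega)
      have : u = 4 ∨ u = 5 ∨ u = 8 ∨ u = 9 ∨ u = 12 ∨ u = 17 ∨ u = 41 ∨ u = 44 := by omega
      rcases this with rfl | rfl | rfl | rfl | rfl | rfl | rfl | rfl
      · exact hasTripleGDD_four
      · exact hasTripleGDD_five.to_fin (by simp)
      · exact hasTripleGDD_eight.to_fin (by simp)
      · exact hasTripleGDD_nine.to_fin (by simp)
      · exact hasTripleGDD_twelve.to_fin (by simp)
      · exact hasTripleGDD_seventeen.to_fin (by simp)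
      · exact hasTripleGDD_forty_one.to_fin (by simp)
      · exact hasTripleGDD_forty_four.to_fin (by simp)

/-- Hanani's theorem: a Steiner system `S(2, 4, v)` exists whenever `v` is `1` or `4` modulo `12`. -/
theorem exists_isQuadSystem {v : ℕ} (hv : v % 12 = 1 ∨ v % 12 = 4) :
    ∃ (ι : Type) (B : ι → Fin 4 → Fin v), IsQuadSystem B := by
  obtain ⟨ι, B, hB⟩ := (hasTripleGDD_fin (v / 3) (by omega)).exists_isQuadSystem
  have hc : Nat.card (Option (Fin (v / 3) × ZMod 3)) = Nat.card (Fin v) := by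
    simp
    omega
  exact ⟨ι, _, hB.comp_equiv (Finite.card_eq.1 hc).some⟩

/-! ### Edges and colours of a clique -/

/-- The edges of the complete graph with both endpoints in `S`. -/
def edgesWithin {V : Type} [DecidableEq V] (S : Finset V) : Finset (Sym2 V) :=
  S.offDiag.image Sym2.mk.uncurry

theorem mk_mem_edgesWithin {V : Type} [DecidableEq V] {S : Finset V} {x y : V} :
    s(x, y) ∈ edgesWithin S ↔ x ∈ S ∧ y ∈ S ∧ x ≠ y := by
  simp only [edgesWithin, Finset.mem_image, Finset.mem_offDiag, Prod.exists, Function.uncurry,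
    Sym2.eq_iff]
  grind

theorem edgesWithin_mono {V : Type} [DecidableEq V] {S T : Finset V} (h : S ⊆ T) :
    edgesWithin S ⊆ edgesWithin T :=
  Finset.image_subset_image (Finset.offDiag_mono h)

theorem card_edgesWithin {V : Type} [DecidableEq V] (S : Finset V) :
    (edgesWithin S).card = S.card.choose 2 :=
  Sym2.card_image_offDiag S

open Classical in
/-- The colour of an unordered pair; a diagonal pair has none. -/
noncomputable def pairColor {V K : Type} (χ : SimpleGraph.TopEdgeLabeling V K) (e : Sym2 V) :
    Option K :=
  if h : e ∈ (⊤ : SimpleGraph V).edgeSet then some (χ ⟨e, h⟩) else none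

theorem pairColor_mk {V K : Type} (χ : SimpleGraph.TopEdgeLabeling V K) {x y : V} (h : x ≠ y) :
    pairColor χ s(x, y) = some (χ.get x y h) :=
  dif_pos h

theorem ncard_colorsWithin {V K : Type} [DecidableEq V] [DecidableEq K]
    (χ : SimpleGraph.TopEdgeLabeling V K) (S : Finset V) :
    (colorsWithin χ S).ncard = ((edgesWithin S).image (pairColor χ)).card := by
  rw [← Set.ncard_coe_finset, ← Set.ncard_image_of_injective _ (Option.some_injective K)]
  congr 1
  ext c
  simp only [colorsWithin, Set.mem_image, Set.mem_ofPred_eq, Finset.coe_image, Finset.mem_coe]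
  constructor
  · rintro ⟨c, ⟨x, y, h, hx, hy, rfl⟩, rfl⟩
    exact ⟨s(x, y), mk_mem_edgesWithin.2 ⟨hx, hy, h⟩, pairColor_mk χ h⟩
  · rintro ⟨e, he, rfl⟩
    induction e using Sym2.inductionOn with
    | _ x y =>
      obtain ⟨hx, hy, h⟩ := mk_mem_edgesWithin.1 he
      exact ⟨_, ⟨x, y, h, hx, hy, rfl⟩, (pairColor_mk χ h).symm⟩

/-! ### Lower bound -/

/-- Two coincidences of colours span at least seven vertices. -/
theorem IsPQColoring.six_lt_card {V K : Type} [DecidableEq V] [Fintype V]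
    {χ : SimpleGraph.TopEdgeLabeling V K} (hχ : IsPQColoring 6 14 χ) (hV : 6 ≤ Fintype.card V)
    {S : Finset V} {d r d' r' : Sym2 V} (hd : d ∈ edgesWithin S) (hr : r ∈ edgesWithin S)
    (hd' : d' ∈ edgesWithin S) (hr' : r' ∈ edgesWithin S) (hdd : d ≠ d') (hrd : r ≠ d)
    (hrd' : r ≠ d') (hr'd : r' ≠ d) (hr'd' : r' ≠ d') (hc : pairColor χ r = pairColor χ d)
    (hc' : pairColor χ r' = pairColor χ d') : 6 < S.card := by
  classical
  by_contra! hS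
  obtain ⟨U, hSU, -, hU⟩ := Finset.exists_subsuperset_card_eq S.subset_univ hS
    (by rwa [Finset.card_univ])
  have hm := edgesWithin_mono hSU
  have h14 := hχ U hU
  rw [ncard_colorsWithin] at h14
  -- Deleting `d` and `d'` loses no colour, since `r` and `r'` survive; this leaves at most 15 - 2
  -- colours.
  have hsub : (edgesWithin U).image (pairColor χ) ⊆
      (((edgesWithin U).erase d).erase d').image (pairColor χ) := by
    intro c hcm
    obtain ⟨e, he, rfl⟩ := Finset.mem_image.1 hcm
    by_cases h1 : e = d
    · subst h1
      exact Finset.mem_image.2 ⟨r, by simp [hrd, hrd', hm hr], hc⟩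
    by_cases h2 : e = d'
    · subst h2
      exact Finset.mem_image.2 ⟨r', by simp [hr'd, hr'd', hm hr'], hc'⟩
    exact Finset.mem_image.2 ⟨e, by simp [h1, h2, he], rfl⟩
  have h13 := (Finset.card_le_card hsub).trans Finset.card_image_le
  rw [Finset.card_erase_of_mem (by simp [hdd.symm, hm hd']), Finset.card_erase_of_mem (hm hd),
    card_edgesWithin, hU] at h13
  have : Nat.choose 6 2 = 15 := by decide
  omega

/-- The two edges may share a vertex; padding to exactly four vertices makes each coincidence occupy
six edges. -/
theorem exists_card_eq_four_of_mem_edgesWithin {V : Type} [DecidableEq V] [Fintype V]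
    (hV : 4 ≤ Fintype.card V) {d r : Sym2 V} (hd : d ∈ edgesWithin (Finset.univ : Finset V))
    (hr : r ∈ edgesWithin (Finset.univ : Finset V)) :
    ∃ T : Finset V, T.card = 4 ∧ d ∈ edgesWithin T ∧ r ∈ edgesWithin T := by
  induction d using Sym2.inductionOn with
  | _ x y =>
  induction r using Sym2.inductionOn with
  | _ z w =>
    obtain ⟨T, hT, -, hc⟩ := Finset.exists_subsuperset_card_eq (Finset.subset_univ {x, y, z, w})
      Finset.card_le_four (by rwa [Finset.card_univ])
    simp only [Finset.insert_subset_iff, Finset.singleton_subset_iff] at hT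
    refine ⟨T, hc, mk_mem_edgesWithin.2 ⟨hT.1, hT.2.1, (mk_mem_edgesWithin.1 hd).2.2⟩,
      mk_mem_edgesWithin.2 ⟨hT.2.2.1, hT.2.2.2, (mk_mem_edgesWithin.1 hr).2.2⟩⟩

theorem IsPQColoring.five_mul_choose_le {V K : Type} [Fintype V] [Fintype K]
    {χ : SimpleGraph.TopEdgeLabeling V K} (hχ : IsPQColoring 6 14 χ) (hV : 6 ≤ Fintype.card V) :
    5 * (Fintype.card V).choose 2 ≤ 6 * Fintype.card K := by
  classical
  set F := edgesWithin (Finset.univ : Finset V) with hF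
  -- `R` contains one edge of each colour used.
  obtain ⟨R, hRF, hR, hRinj⟩ : ∃ R ⊆ F, F.image (pairColor χ) = R.image (pairColor χ) ∧
      Set.InjOn (pairColor χ) R := by
    obtain ⟨R, h1, h2, h3⟩ := Finset.exists_subset_injOn_image_eq_of_surjOn F
      (F.image (pairColor χ)) (f := pairColor χ) (by rw [Finset.coe_image]; exact Set.surjOn_image _ _)
    exact ⟨R, by exact_mod_cast h1, h3.symm, h2⟩
  have hRcard : R.card ≤ Fintype.card K := by
    rw [← Finset.card_image_of_injOn hRinj, ← hR, ← ncard_colorsWithin, ← Nat.card_eq_fintype_card]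
    exact Set.ncard_le_card _
  have hex : ∀ d : {d // d ∈ F \ R}, ∃ r ∈ R, pairColor χ r = pairColor χ d.1 := by
    intro d
    have := Finset.mem_image_of_mem (pairColor χ) (Finset.mem_sdiff.1 d.2).1
    rwa [hR, Finset.mem_image] at this
  choose r hrR hrc using hex
  choose T hT4 hTd hTr using fun d : {d // d ∈ F \ R} =>
    exists_card_eq_four_of_mem_edgesWithin (by omega) (Finset.mem_sdiff.1 d.2).1 (hRF (hrR d))
  have hdis : ∀ d ∈ (F \ R).attach, ∀ d' ∈ (F \ R).attach, d ≠ d' →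
      Disjoint (edgesWithin (T d)) (edgesWithin (T d')) := by
    intro d _ d' _ hdd
    rw [Finset.disjoint_left]
    intro e he he'
    have hne : ∀ d d' : {d // d ∈ F \ R}, r d ≠ d'.1 := fun d d' h =>
      (Finset.mem_sdiff.1 d'.2).2 (h ▸ hrR d)
    have h7 := hχ.six_lt_card hV
      (edgesWithin_mono Finset.subset_union_left (hTd d))
      (edgesWithin_mono Finset.subset_union_left (hTr d))
      (edgesWithin_mono Finset.subset_union_right (hTd d'))
      (edgesWithin_mono Finset.subset_union_right (hTr d'))
      (fun h => hdd (Subtype.ext h)) (hne _ _) (hne _ _) (hne _ _) (hne _ _) (hrc d) (hrc d')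
    -- A common edge forces the union to have at most 4 + 4 - 2 = 6 vertices, against `h7`.
    have h2 : 2 ≤ (T d ∩ T d').card := by
      induction e using Sym2.inductionOn with
      | _ x y =>
        rw [mk_mem_edgesWithin] at he he'
        rw [← Finset.card_pair he.2.2]
        apply Finset.card_le_card
        simp [Finset.insert_subset_iff, he, he']
    have := Finset.card_union_add_card_inter (T d) (T d')
    rw [hT4, hT4] at this
    omega
  have hsum : ((F \ R).attach.biUnion fun d => edgesWithin (T d)).card = (F \ R).card * 6 := by
    rw [Finset.card_biUnion hdis, Finset.sum_const_nat (m := 6), Finset.card_attach]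
    intro d _
    rw [card_edgesWithin, hT4]
    decide
  have hle : ((F \ R).attach.biUnion fun d => edgesWithin (T d)).card ≤ F.card :=
    Finset.card_le_card (Finset.biUnion_subset.2 fun d _ => edgesWithin_mono (Finset.subset_univ _))
  have hFc : F.card = (Fintype.card V).choose 2 := by
    rw [hF, card_edgesWithin, Finset.card_univ]
  have := Finset.card_sdiff_add_card_eq_card hRF
  omega

/-! ### Upper bound -/

theorem IsPQColoring.pullback {V W K : Type} {p q : ℕ} {χ : SimpleGraph.TopEdgeLabeling V K}
    (hχ : IsPQColoring p q χ) (f : W ↪ V) :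
    IsPQColoring p q (SimpleGraph.TopEdgeLabeling.pullback χ f) := by
  intro S hS
  have := hχ (S.map f) (by rwa [Finset.card_map])
  convert this using 2
  ext c
  constructor
  · rintro ⟨x, y, h, hx, hy, rfl⟩
    exact ⟨f x, f y, f.injective.ne h, Finset.mem_map_of_mem f hx, Finset.mem_map_of_mem f hy, rfl⟩
  · rintro ⟨x, y, h, hx, hy, rfl⟩
    obtain ⟨x', hx', rfl⟩ := Finset.mem_map.1 hx
    obtain ⟨y', hy', rfl⟩ := Finset.mem_map.1 hy
    exact ⟨x', y', fun hxy => h (by rw [hxy]), hx', hy', rfl⟩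

theorem IsPQColoring.compRight {V K K' : Type} {p q : ℕ} {χ : SimpleGraph.TopEdgeLabeling V K}
    (hχ : IsPQColoring p q χ) (f : K ↪ K') : IsPQColoring p q (χ.compRight f) := by
  intro S hS
  have := hχ S hS
  rw [← Set.ncard_image_of_injective _ f.injective] at this
  convert this using 2
  ext c
  constructor
  · rintro ⟨x, y, h, hx, hy, rfl⟩
    exact ⟨_, ⟨x, y, h, hx, hy, rfl⟩, rfl⟩
  · rintro ⟨_, ⟨x, y, h, hx, hy, rfl⟩, rfl⟩
    exact ⟨x, y, h, hx, hy, rfl⟩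

/-- Double counting: each ordered pair of distinct points is one of the 12 ordered pairs of a unique
block. -/
theorem IsQuadSystem.twelve_mul_card {V ι : Type} [Fintype V] {B : ι → Fin 4 → V}
    (hB : IsQuadSystem B) : Finite ι ∧ 12 * Nat.card ι = Fintype.card V * (Fintype.card V - 1) := by
  classical
  let g : ι × {p : Fin 4 × Fin 4 // p.1 ≠ p.2} → {p : V × V // p.1 ≠ p.2} :=
    fun w => ⟨(B w.1 w.2.1.1, B w.1 w.2.1.2), (hB.1 w.1).ne w.2.2⟩
  have hg : Function.Bijective g := by
    constructor
    · rintro ⟨i, ⟨a, b⟩, hab⟩ ⟨j, ⟨a', b'⟩, hab'⟩ h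
      simp only [g, Subtype.mk.injEq, Prod.mk.injEq] at h
      have := (hB.2 _ _ ((hB.1 i).ne hab)).unique (y₁ := (i, a, b)) (y₂ := (j, a', b'))
        ⟨rfl, rfl⟩ ⟨h.1.symm, h.2.symm⟩
      simp only [Prod.mk.injEq] at this
      obtain ⟨rfl, rfl, rfl⟩ := this
      rfl
    · rintro ⟨⟨x, y⟩, hxy⟩
      obtain ⟨⟨i, a, b⟩, ⟨h1, h2⟩, -⟩ := hB.2 x y hxy
      refine ⟨(i, ⟨(a, b), ?_⟩), Subtype.ext (Prod.ext h1 h2)⟩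
      intro hab
      obtain rfl : a = b := hab
      exact hxy (h1.symm.trans h2)
  have hfin : Finite (ι × {p : Fin 4 × Fin 4 // p.1 ≠ p.2}) := Finite.of_injective g hg.1
  refine ⟨Finite.of_injective (fun i => (i, (⟨(0, 1), by decide⟩ : {p : Fin 4 × Fin 4 // p.1 ≠ p.2})))
    fun i j h => congrArg Prod.fst h, ?_⟩
  have hc := Nat.card_congr (Equiv.ofBijective g hg)
  rw [Nat.card_prod] at hc
  have h12 : Nat.card {p : Fin 4 × Fin 4 // p.1 ≠ p.2} = 12 := by
    rw [Nat.card_eq_fintype_card]; decide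
  have hV : Nat.card {p : V × V // p.1 ≠ p.2} = Fintype.card V * (Fintype.card V - 1) := by
    rw [Nat.card_eq_fintype_card, Fintype.card_subtype, ← Finset.card_univ, Nat.mul_sub_one,
      ← Finset.offDiag_card]
    congr 1
    ext p
    simp
  rw [← hV, ← hc, h12, mul_comm]

/-- Colour the six pairs of a block with five colours, repeated on a pair of opposite edges. -/
def blockColor (a b : Fin 4) : Fin 5 :=
  -- Colour 0 is the repeated one, on {0, 1} and {2, 3}; the diagonal entries are junk.
  ![![0, 0, 1, 2], ![0, 0, 3, 4], ![1, 3, 0, 0], ![2, 4, 0, 0]] a b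

theorem IsQuadSystem.exists_isPQColoring {V ι : Type} {B : ι → Fin 4 → V} (hB : IsQuadSystem B) :
    ∃ χ : SimpleGraph.TopEdgeLabeling V (ι × Fin 5), IsPQColoring 6 14 χ := by
  classical
  choose w hw hwu using hB.2
  have hwB : ∀ i a b, a ≠ b → ∀ h, w (B i a) (B i b) h = (i, a, b) := fun i a b _ h =>
    (hwu _ _ h (i, a, b) ⟨rfl, rfl⟩).symm
  let χ : SimpleGraph.TopEdgeLabeling V (ι × Fin 5) :=
    SimpleGraph.EdgeLabeling.mk
      (fun x y h => ((w x y h).1, blockColor (w x y h).2.1 (w x y h).2.2)) (by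
        intro x y h
        have := hwu y x h.symm ((w x y h).1, (w x y h).2.2, (w x y h).2.1)
          ⟨(hw x y h).2, (hw x y h).1⟩
        rw [← this]
        have hs : ∀ a b, blockColor a b = blockColor b a := by decide
        rw [hs])
  have hχ : ∀ i a b, a ≠ b → pairColor χ s(B i a, B i b) = some (i, blockColor a b) := by
    intro i a b hab
    have hne := (hB.1 i).ne hab
    rw [pairColor_mk χ hne, SimpleGraph.EdgeLabeling.get_mk, hwB i a b hab]
  have hrep : ∀ e, ¬ e.IsDiag → ∃ i a b, a ≠ b ∧ e = s(B i a, B i b) := by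
    intro e he
    induction e using Sym2.inductionOn with
    | _ x y =>
      rw [Sym2.mk_isDiag_iff] at he
      obtain ⟨h1, h2⟩ := hw x y he
      refine ⟨(w x y he).1, (w x y he).2.1, (w x y he).2.2, fun h => he ?_, by rw [h1, h2]⟩
      exact h1.symm.trans ((congrArg (B _) h).trans h2)
  refine ⟨χ, fun S hS => ?_⟩
  rw [ncard_colorsWithin]
  have hnd : ∀ e ∈ edgesWithin S, ¬ e.IsDiag := by
    intro e he
    induction e using Sym2.inductionOn with
    | _ x y => exact (mk_mem_edgesWithin.1 he).2.2
  -- Two blocks inside a 6-set would share two points, hence coincide.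
  have hone : ∀ i j, (∀ a, B i a ∈ S) → (∀ a, B j a ∈ S) → i = j := by
    intro i j hi hj
    by_contra hij
    have hc : ∀ i, (Finset.univ.image (B i)).card = 4 := fun i => by
      rw [Finset.card_image_of_injective _ (hB.1 i)]; rfl
    have hu : (Finset.univ.image (B i) ∪ Finset.univ.image (B j)).card ≤ 6 := by
      rw [← hS]
      apply Finset.card_le_card
      intro x
      simp only [Finset.mem_union, Finset.mem_image, Finset.mem_univ, true_and]
      rintro (⟨a, rfl⟩ | ⟨a, rfl⟩)
      exacts [hi a, hj a]
    have := Finset.card_union_add_card_inter (Finset.univ.image (B i)) (Finset.univ.image (B j))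
    rw [hc, hc] at this
    obtain ⟨x, hx, y, hy, hxy⟩ := Finset.one_lt_card.1
      (show 1 < (Finset.univ.image (B i) ∩ Finset.univ.image (B j)).card by omega)
    simp only [Finset.mem_inter, Finset.mem_image, Finset.mem_univ, true_and] at hx hy
    obtain ⟨⟨a, ha⟩, ⟨a', ha'⟩⟩ := hx
    obtain ⟨⟨b, hb⟩, ⟨b', hb'⟩⟩ := hy
    exact hij (congrArg Prod.fst ((hB.2 x y hxy).unique (y₁ := (i, a, b)) (y₂ := (j, a', b'))
      ⟨ha, hb⟩ ⟨ha', hb'⟩))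
  -- `D` holds the redundant edge {2, 3} of the block inside `S`, if there is one; the remaining
  -- edges have distinct colours.
  let D := (edgesWithin S).filter fun e => ∃ i, (∀ a, B i a ∈ S) ∧ e = s(B i 2, B i 3)
  have hD : D.card ≤ 1 := by
    rw [Finset.card_le_one]
    intro e he e' he'
    obtain ⟨i, hi, rfl⟩ := (Finset.mem_filter.1 he).2
    obtain ⟨j, hj, rfl⟩ := (Finset.mem_filter.1 he').2
    rw [hone i j hi hj]
  have hinj : Set.InjOn (pairColor χ) (edgesWithin S \ D : Finset _) := by
    intro e he e' he' hee
    rw [Finset.mem_coe, Finset.mem_sdiff] at he he'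
    obtain ⟨i, a, b, hab, rfl⟩ := hrep e (hnd e he.1)
    obtain ⟨j, a', b', hab', rfl⟩ := hrep e' (hnd e' he'.1)
    rw [hχ i a b hab, hχ j a' b' hab', Option.some_inj, Prod.mk.injEq] at hee
    obtain ⟨rfl, hcol⟩ := hee
    -- Distinct edges of one colour are opposite, so together they put the whole block in `S`, and
    -- one of them lies in `D`.
    have hcomb : ∀ a b a' b' : Fin 4, a ≠ b → a' ≠ b' → blockColor a b = blockColor a' b' →
        s(a, b) = s(a', b') ∨ ((s(a, b) = s(2, 3) ∨ s(a', b') = s(2, 3)) ∧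
          ∀ c, c = a ∨ c = b ∨ c = a' ∨ c = b') := by decide
    rcases hcomb a b a' b' hab hab' hcol with h | ⟨h, hall⟩
    · exact congrArg (Sym2.map (B i)) h
    · have h1 := mk_mem_edgesWithin.1 he.1
      have h2 := mk_mem_edgesWithin.1 he'.1
      have hS : ∀ c, B i c ∈ S := by
        intro c
        rcases hall c with rfl | rfl | rfl | rfl
        exacts [h1.1, h1.2.1, h2.1, h2.2.1]
      rcases h with h | h
      · exact (he.2 (Finset.mem_filter.2 ⟨he.1, i, hS, congrArg (Sym2.map (B i)) h⟩)).elim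
      · exact (he'.2 (Finset.mem_filter.2 ⟨he'.1, i, hS, congrArg (Sym2.map (B i)) h⟩)).elim
  calc 14 ≤ (edgesWithin S \ D).card := by
        rw [Finset.card_sdiff_of_subset (Finset.filter_subset _ _), card_edgesWithin, hS]
        exact Nat.sub_le_sub_left hD 15
    _ = ((edgesWithin S \ D).image (pairColor χ)).card := (Finset.card_image_of_injOn hinj).symm
    _ ≤ _ := Finset.card_le_card (Finset.image_subset_image Finset.sdiff_subset)

/-! ### Bounds for the generalized Ramsey number -/

theorem exists_isPQColoring_of_le {n m : ℕ} (hnm : n ≤ m) (hm : m % 12 = 1 ∨ m % 12 = 4) :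
    ∃ k : ℕ, 12 * k = 5 * (m * (m - 1)) ∧
      ∃ χ : SimpleGraph.TopEdgeLabeling (Fin n) (Fin k), IsPQColoring 6 14 χ := by
  obtain ⟨ι, B, hB⟩ := exists_isQuadSystem hm
  obtain ⟨χ, hχ⟩ := hB.exists_isPQColoring
  obtain ⟨hfin, hcard⟩ := hB.twelve_mul_card
  rw [Fintype.card_fin] at hcard
  refine ⟨Nat.card (ι × Fin 5), ?_, _, (hχ.pullback (Fin.castLEEmb hnm)).compRight
    (Finite.equivFin (ι × Fin 5)).toEmbedding⟩
  rw [Nat.card_prod, Nat.card_fin, ← hcard]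
  ring

theorem twelve_mul_genRamsey_le {n m : ℕ} (hnm : n ≤ m) (hm : m % 12 = 1 ∨ m % 12 = 4) :
    12 * genRamsey n 6 14 ≤ 5 * (m * (m - 1)) := by
  obtain ⟨k, hk, hχ⟩ := exists_isPQColoring_of_le hnm hm
  rw [← hk]
  exact Nat.mul_le_mul_left _ (Nat.sInf_le hχ)

theorem five_mul_choose_le_genRamsey {n : ℕ} (hn : 6 ≤ n) :
    5 * n.choose 2 ≤ 6 * genRamsey n 6 14 := by
  -- Since `sInf ∅ = 0`, some colouring must exist before the infimum is attained; any admissible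
  -- size at least n will do.
  obtain ⟨k, -, hk⟩ := exists_isPQColoring_of_le (m := 12 * n + 1) (n := n) (by omega) (by omega)
  obtain ⟨χ, hχ⟩ := Nat.sInf_mem (s := {k | ∃ χ : SimpleGraph.TopEdgeLabeling (Fin n) (Fin k),
    IsPQColoring 6 14 χ}) ⟨k, hk⟩
  simpa [genRamsey] using hχ.five_mul_choose_le (by simpa using hn)

theorem theorem5 :
    (∀ n : ℕ, 6 ≤ n →
      (5 / 6 : ℝ) * (n.choose 2 : ℝ) ≤ (genRamsey n 6 14 : ℝ)) ∧
    (∃ C : ℝ, ∀ n : ℕ, 6 ≤ n →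
      (genRamsey n 6 14 : ℝ) ≤ (5 / 6 : ℝ) * (n.choose 2 : ℝ) + C * (n : ℝ)) ∧
    (∀ n : ℕ, 6 ≤ n → (n % 12 = 1 ∨ n % 12 = 4) →
      (genRamsey n 6 14 : ℝ) = (5 / 6 : ℝ) * (n.choose 2 : ℝ)) := by
  have hlow : ∀ n : ℕ, 6 ≤ n → (5 / 6 : ℝ) * (n.choose 2 : ℝ) ≤ (genRamsey n 6 14 : ℝ) := by
    intro n hn
    have : (5 * n.choose 2 : ℝ) ≤ 6 * genRamsey n 6 14 := by
      exact_mod_cast five_mul_choose_le_genRamsey hn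
    linarith
  have hup : ∀ n m : ℕ, n ≤ m → 1 ≤ m → (m % 12 = 1 ∨ m % 12 = 4) →
      (12 * genRamsey n 6 14 : ℝ) ≤ 5 * (m * (m - 1)) := by
    intro n m hnm h1 hm
    have : ((12 * genRamsey n 6 14 : ℕ) : ℝ) ≤ ((5 * (m * (m - 1)) : ℕ) : ℝ) :=
      Nat.cast_le.2 (twelve_mul_genRamsey_le hnm hm)
    push_cast [h1] at this
    exact this
  -- The constant 100 is generous: m ≤ n + 11 gives an excess of at most 5(22n + 110)/12, which is
  -- below 17n for n ≥ 6.
  refine ⟨hlow, ⟨100, fun n hn => ?_⟩, fun n hn hm => le_antisymm ?_ (hlow n hn)⟩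
  · obtain ⟨m, hnm, hmn, hm⟩ : ∃ m, n ≤ m ∧ m ≤ n + 11 ∧ m % 12 = 1 :=
      ⟨n + (13 - n % 12) % 12, by omega, by omega, by omega⟩
    have h := hup n m hnm (by omega) (.inl hm)
    have h1 : (m : ℝ) ≤ n + 11 := by exact_mod_cast hmn
    have h2 : (6 : ℝ) ≤ n := by exact_mod_cast hn
    have h3 : (n : ℝ) ≤ m := by exact_mod_cast hnm
    rw [Nat.cast_choose_two]
    nlinarith
  · have h := hup n n le_rfl (by omega) hm
    rw [Nat.cast_choose_two]
    linarith
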